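/- For $\gamma\in(0,1]$, $\lambda\ge 0$ and $\kappa\in[0,1)$, the positive discrete stable law $\mathrm{PDS}(\gamma,\lambda,\kappa)$ is the law on $\{0,1,2,\dots\}$ with probability generating function $$\mathbb E\,z^X=\exp\left\{-\lambda\left(\frac{1-z}{1-\kappa z}\right)^{\gamma}\right\},\qquad 0\le z\le 1 .$$ Let $\gamma,\gamma'\in(0,1]$ with $\gamma'\le\gamma$, let $\lambda>0$ and $\kappa\in[0,1)$, and let $S_\gamma\ge 0$ be a $\gamma$-stable random variable with Laplace transform $\mathbb E\,e^{-uS_\gamma}=\exp\{-u^\gamma\}$, $u\ge 0$. Then: (i) For every $\delta\in(0,1]$ and $t\ge 0$ the law $\mathrm{PDS}(\delta,t,\kappa)$ exists and is unique, and it depends measurably on $t$. (ii) $$\mathrm{PDS}(\gamma',\lambda,\kappa)\stackrel{d}{=}\mathrm{PDS}\left(\gamma'/\gamma,\ \lambda^{1/\gamma}S_\gamma,\ \kappa\right),$$ that is, if $Z$ is a random variable with values in $\{0,1,2,\dots\}$ whose conditional law given $S_\gamma=s$ is $\mathrm{PDS}(\gamma'/\gamma,\lambda^{1/\gamma}s,\kappa)$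 for almost every $s$ with respect to the law of $S_\gamma$, then $Z$ has the law $\mathrm{PDS}(\gamma',\lambda,\kappa)$. (iii) Let $Y_1,Y_2,\dots$ be i.i.d. with the geometric law $\mathbb P(Y_j=n)=(1-\kappa)\kappa^{n-1}$, $n\ge 1$, and let $N$ be a random variable, independent of the sequence $(Y_j)$, that has the Poisson law with random intensity $\lambda^{1/\gamma}S_\gamma$ (its conditional law given $S_\gamma=s$ is Poisson with mean $\lambda^{1/\gamma}s$ for almost every $s$ with respect to the law of $S_\gamma$). Then $\sum_{j=1}^N Y_j$ has the law $\mathrm{PDS}(\gamma,\lambda,\kappa)$. -/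

import Mathlib

open MeasureTheory ProbabilityTheory
open scoped NNReal

/-- The positive discrete stable law `PDS(γ, lam, κ)` (on the lattice `ℕ`, i.e. `m = 1`): the
probability measure on `ℕ` with probability generating function
`E z ^ X = exp (-lam * ((1 - z) / (1 - κ z)) ^ γ)`, `0 ≤ z ≤ 1`.
The value `lam = 0` gives the point mass at `0`. -/
structure IsPDS (γ lam κ : ℝ) (μ : Measure ℕ) : Prop where
  isProbabilityMeasure : IsProbabilityMeasure μ
  pgf_eq : ∀ z ∈ Set.Icc (0 : ℝ) 1,
    ∫ n : ℕ, z ^ n ∂μ = Real.exp (-(lam * ((1 - z) / (1 - κ * z)) ^ γ))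

/-- The positive `γ`-stable law with Laplace transform `exp (-u ^ γ)`, `u ≥ 0`
(for `γ = 1` the point mass at `1`). -/
structure IsPositiveStable (γ : ℝ) (σ : Measure ℝ) : Prop where
  isProbabilityMeasure : IsProbabilityMeasure σ
  nonneg : ∀ᵐ s ∂σ, 0 ≤ s
  laplace_eq : ∀ u : ℝ, 0 ≤ u → ∫ s : ℝ, Real.exp (-(u * s)) ∂σ = Real.exp (-u ^ γ)

/-- The geometric law on `{1, 2, …}`: mass `(1 - κ) * κ ^ (n - 1)` at each `n ≥ 1`. -/
structure IsGeometricFromOne (κ : ℝ) (μ : Measure ℕ) : Prop where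
  isProbabilityMeasure : IsProbabilityMeasure μ
  mass_eq : ∀ n : ℕ, μ.real {n + 1} = (1 - κ) * κ ^ n

/-! Put `x = (1 - z) / (1 - κ * z)`. The geometric law has generating function `1 - x`; a
Sibuya(`δ`) number of geometric variables has `1 - x ^ δ`; a Poisson(`t`) number of such sums has
`exp (-t * x ^ δ)`, which gives existence. Only the Poisson factor depends on `t`, hence
measurability, and a generating function determines its law, hence uniqueness
(`exists_kernel_isPDS`, `measure_eq_of_integral_pow_eq`).

Mixing over `S` evaluates the stable Laplace transform: at `u = lam ^ (1 / γ) * x ^ (γ' / γ)` it is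
`exp (-lam * x ^ γ')`. For the random sum, the mixed Poisson generating function `exp (-lam * (1 -
w) ^ γ)` is taken at `w = 1 - x`. -/

/-! ### Generating functions of laws on `ℕ` -/

lemma integrable_pow_of_mem_Icc {z : ℝ} (hz : z ∈ Set.Icc (0 : ℝ) 1) {α : Type*}
    [MeasurableSpace α] (μ : Measure α) [IsFiniteMeasure μ] {X : α → ℕ} (hX : Measurable X) :
    Integrable (fun a => z ^ X a) μ :=
  Integrable.of_bound ((Measurable.of_discrete (f := fun n : ℕ => z ^ n)).comp hX).aestronglyMeasurable
    1 (ae_of_all _ fun a => by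
      rw [Real.norm_of_nonneg (pow_nonneg hz.1 _)]; exact pow_le_one₀ hz.1 hz.2)

lemma hasSum_integral_pow {z : ℝ} (hz : z ∈ Set.Icc (0 : ℝ) 1) (μ : Measure ℕ)
    [IsFiniteMeasure μ] : HasSum (fun n => μ.real {n} * z ^ n) (∫ n : ℕ, z ^ n ∂μ) := by
  have h := integrable_pow_of_mem_Icc hz μ measurable_id
  simp only [id] at h
  rw [← Measure.sum_smul_dirac μ] at h
  have := hasSum_integral_measure h
  rw [Measure.sum_smul_dirac μ] at this
  simpa [integral_smul_measure, measureReal_def] using this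

/-- A power series with bounded coefficients that vanishes on `[0, 1)` is zero. -/
lemma eq_zero_of_hasSum_mul_pow_zero {e : ℕ → ℝ} {C : ℝ} (he : ∀ n, |e n| ≤ C)
    (h : ∀ z ∈ Set.Ioo (0 : ℝ) 1, HasSum (fun n => e n * z ^ n) 0) : e = 0 := by
  set p := FormalMultilinearSeries.ofScalars ℝ e with hp
  have hr : (1 : ENNReal) ≤ p.radius := by
    refine p.le_radius_of_bound C (r := 1) fun n => ?_
    simpa [hp, FormalMultilinearSeries.ofScalars_norm] using he n
  have hps := (p.hasFPowerSeriesOnBall (lt_of_lt_of_le one_pos hr)).hasFPowerSeriesAt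
  by_contra hne
  have hp0 : p ≠ 0 := fun h0 => hne (FormalMultilinearSeries.ofScalars_series_eq_zero ℝ |>.1 h0)
  -- Isolated zeros: a nonzero series has no zeros in a punctured neighbourhood of `0`, in
  -- particular none just to the right of `0`, where the sum vanishes.
  have hnz := hps.locally_ne_zero hp0
  have hnz' := hnz.filter_mono (nhdsWithin_mono (0 : ℝ) (fun x (hx : x ∈ Set.Ioi (0 : ℝ)) => ne_of_gt hx))
  obtain ⟨z, hz1, hz2⟩ := (hnz'.and (Ioo_mem_nhdsGT (zero_lt_one (α := ℝ)))).exists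
  apply hz1
  change FormalMultilinearSeries.ofScalarsSum e z = 0
  rw [FormalMultilinearSeries.ofScalars_sum_eq]
  simpa using (h z hz2).tsum_eq

/-- A probability measure on `ℕ` is determined by its generating function on `[0, 1]`. -/
lemma measure_eq_of_integral_pow_eq {μ ν : Measure ℕ} [IsProbabilityMeasure μ]
    [IsProbabilityMeasure ν]
    (h : ∀ z ∈ Set.Icc (0 : ℝ) 1, ∫ n : ℕ, z ^ n ∂μ = ∫ n : ℕ, z ^ n ∂ν) : μ = ν := by
  have key : (fun n => μ.real {n} - ν.real {n}) = 0 := by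
    refine eq_zero_of_hasSum_mul_pow_zero (C := 1) (fun n => ?_) fun z hz => ?_
    · have h1 := measureReal_nonneg (μ := μ) (s := {n})
      have h2 := measureReal_nonneg (μ := ν) (s := {n})
      have h3 := measureReal_le_one (μ := μ) (s := {n})
      have h4 := measureReal_le_one (μ := ν) (s := {n})
      rw [abs_le]; constructor <;> linarith
    · have hz' := Set.Ioo_subset_Icc_self hz
      have := (hasSum_integral_pow hz' μ).sub (hasSum_integral_pow hz' ν)
      rw [h z hz', sub_self] at this
      simpa [sub_mul] using this
  refine Measure.ext_of_singleton fun n => ?_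
  have := congrFun key n
  simp only [Pi.zero_apply, sub_eq_zero] at this
  rwa [measureReal_def, measureReal_def, ENNReal.toReal_eq_toReal_iff' (by simp) (by simp)] at this

lemma integral_pow_poissonMeasure (r : ℝ≥0) (z : ℝ) (hz : z ∈ Set.Icc (0 : ℝ) 1) :
    ∫ n : ℕ, z ^ n ∂(poissonMeasure r) = Real.exp (-(r * (1 - z))) := by
  have h1 := hasSum_integral_poissonMeasure (r := r)
    (integrable_pow_of_mem_Icc hz (poissonMeasure r) measurable_id)
  have h2 := (NormedSpace.expSeries_div_hasSum_exp (r * z : ℝ)).mul_left (Real.exp (-r))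
  rw [← Real.exp_eq_exp_ℝ, ← Real.exp_add] at h2
  rw [show -(r * (1 - z) : ℝ) = -r + r * z by ring]
  exact h1.unique (h2.congr_fun fun n => by simp only [id, smul_eq_mul, mul_pow]; ring)

lemma measurable_poissonMeasure : Measurable poissonMeasure := by
  refine Measure.measurable_of_measurable_coe _ fun s _ => ?_
  simp_rw [← Measure.tsum_indicator_apply_singleton _ s (MeasurableSet.of_discrete)]
  refine Measurable.tsum fun n => ?_
  by_cases hn : n ∈ s
  · simp only [Set.indicator_of_mem hn, poissonMeasure_singleton]
    fun_prop
  · simp [hn]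

/-- Powers of the generating function of a law on `ℕ` are generating functions. -/
lemma exists_kernel_integral_pow_eq_pow (ν : Measure ℕ) [IsProbabilityMeasure ν] :
    ∃ K : Kernel ℕ ℕ, IsMarkovKernel K ∧ ∀ j, ∀ z ∈ Set.Icc (0 : ℝ) 1,
      ∫ n : ℕ, z ^ n ∂(K j) = (∫ n : ℕ, z ^ n ∂ν) ^ j := by
  have h : ∀ j : ℕ, ∃ m : Measure ℕ, IsProbabilityMeasure m ∧ ∀ z ∈ Set.Icc (0 : ℝ) 1,
      ∫ n : ℕ, z ^ n ∂m = (∫ n : ℕ, z ^ n ∂ν) ^ j := by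
    intro j
    induction j with
    | zero => exact ⟨Measure.dirac 0, inferInstance, fun z _ => by simp⟩
    | succ j ih =>
      obtain ⟨m, hm, hmz⟩ := ih
      refine ⟨(m.prod ν).map (fun x => x.1 + x.2),
        Measure.isProbabilityMeasure_map (by fun_prop), fun z hz => ?_⟩
      rw [integral_map (by fun_prop) (by fun_prop)]
      simp_rw [pow_add]
      rw [integral_prod_mul (fun n : ℕ => z ^ n) (fun n : ℕ => z ^ n), hmz z hz, pow_succ]
      simp
  choose m hm hmz using h
  exact ⟨⟨m, Measurable.of_discrete⟩, ⟨hm⟩, hmz⟩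

lemma integral_pow_comp {α : Type*} [MeasurableSpace α] (K : Kernel α ℕ) [IsMarkovKernel K]
    (μ : Measure α) [IsProbabilityMeasure μ] {z : ℝ} (hz : z ∈ Set.Icc (0 : ℝ) 1) :
    ∫ n : ℕ, z ^ n ∂(K ∘ₘ μ) = ∫ a, ∫ n : ℕ, z ^ n ∂(K a) ∂μ := by
  rw [← Measure.snd_compProd, Measure.snd, integral_map (by fun_prop) (by fun_prop),
    Measure.integral_compProd (integrable_pow_of_mem_Icc hz _ measurable_snd)]

lemma exists_measureReal_singleton_eq {c : ℕ → ℝ} (hc : ∀ n, 0 ≤ c n) (h1 : HasSum c 1) :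
    ∃ μ : Measure ℕ, IsProbabilityMeasure μ ∧ ∀ n, μ.real {n} = c n := by
  refine ⟨_, h1.isProbabilityMeasure_sum_dirac hc (d := id), fun n => ?_⟩
  have := Measure.sum_smul_dirac_singleton (f := fun n => ENNReal.ofReal (c n)) (a := n)
  rw [measureReal_def]
  exact (congrArg ENNReal.toReal this).trans (ENNReal.toReal_ofReal (hc n))

/-! ### The Sibuya law -/

lemma succ_mul_ring_choose_succ (a : ℝ) (n : ℕ) :
    (n + 1 : ℝ) * Ring.choose a (n + 1) = (a - n) * Ring.choose a n := by
  rw [Ring.choose_eq_smul, Ring.choose_eq_smul, descPochhammer_succ_right, Polynomial.smeval_mul]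
  have : ((n + 1).factorial : ℝ) = (n + 1) * n.factorial := by push_cast [Nat.factorial_succ]; ring
  have hn : (n.factorial : ℝ) ≠ 0 := by positivity
  have hn1 : (n + 1 : ℝ) ≠ 0 := by positivity
  simp only [smul_eq_mul, this, Polynomial.smeval_sub, Polynomial.smeval_X,
    Polynomial.smeval_natCast, pow_one, pow_zero, nsmul_eq_mul, mul_one]
  field_simp

/-- The coefficients of `w ↦ 1 - (1 - w) ^ δ` are nonnegative for `δ ∈ (0, 1]`. -/
lemma neg_one_pow_mul_ring_choose_nonneg {δ : ℝ} (hδ : δ ∈ Set.Ioc (0 : ℝ) 1) (n : ℕ) :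
    0 ≤ (-1) ^ n * Ring.choose δ (n + 1) := by
  induction n with
  | zero => simpa using hδ.1.le
  | succ n ih =>
    have h := succ_mul_ring_choose_succ δ (n + 1)
    have hpos : (0 : ℝ) < (n + 1 : ℕ) + 1 := by positivity
    refine nonneg_of_mul_nonneg_right (b := (-1) ^ (n + 1) * Ring.choose δ (n + 1 + 1)) ?_ hpos
    -- The bound `δ ≤ 1` enters here: every factor `δ - k` with `k ≥ 1` is nonpositive, so the signs
    -- alternate.
    have h1 : (0 : ℝ) ≤ (n + 1 : ℕ) - δ := by push_cast; have := hδ.2; have := n.cast_nonneg (α := ℝ); linarith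
    calc (0 : ℝ) ≤ ((n + 1 : ℕ) - δ) * ((-1) ^ n * Ring.choose δ (n + 1)) := mul_nonneg h1 ih
      _ = (-1) ^ (n + 1) * ((δ - (n + 1 : ℕ)) * Ring.choose δ (n + 1)) := by ring
      _ = _ := by rw [← h]; ring

lemma hasSum_one_sub_rpow (δ : ℝ) {w : ℝ} (hw : w ∈ Set.Ico (0 : ℝ) 1) :
    HasSum (fun n : ℕ => ((-1) ^ n * Ring.choose δ (n + 1)) * w ^ (n + 1))
      (1 - (1 - w) ^ δ) := by
  have h := (Real.one_add_rpow_hasFPowerSeriesOnBall_zero (a := δ)).hasSum (y := -w) (by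
    rw [Metric.mem_eball, edist_zero_right, enorm_neg, Real.enorm_of_nonneg hw.1]
    exact ENNReal.ofReal_lt_one.2 hw.2)
  simp only [binomialSeries_apply, List.ofFn_const, List.prod_replicate, smul_eq_mul] at h
  rw [← hasSum_nat_add_iff' 1] at h
  have h' := h.neg.congr_fun (g := fun n : ℕ => (-1) ^ n * Ring.choose δ (n + 1) * w ^ (n + 1))
    fun n => by rw [neg_pow w, pow_succ (-1 : ℝ)]; ring
  simpa [sub_eq_add_neg, add_comm] using h'

/-- The Sibuya law: the law on `ℕ` with generating function `1 - (1 - w) ^ δ`. -/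
lemma exists_sibuya {δ : ℝ} (hδ : δ ∈ Set.Ioc (0 : ℝ) 1) :
    ∃ μ : Measure ℕ, IsProbabilityMeasure μ ∧ ∀ w ∈ Set.Icc (0 : ℝ) 1,
      ∫ n : ℕ, w ^ n ∂μ = 1 - (1 - w) ^ δ := by
  set a : ℕ → ℝ := fun n => n.casesOn 0 fun m => (-1) ^ m * Ring.choose δ (m + 1) with ha
  have ha0 : ∀ n, 0 ≤ a n := by
    rintro (_ | n)
    · exact le_rfl
    · exact neg_one_pow_mul_ring_choose_nonneg hδ n
  have hlt : ∀ w ∈ Set.Ico (0 : ℝ) 1, HasSum (fun n => a n * w ^ n) (1 - (1 - w) ^ δ) := by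
    intro w hw
    rw [← hasSum_nat_add_iff' 1]
    simpa [ha] using hasSum_one_sub_rpow δ hw
  have hmem : Set.Ico (0 : ℝ) 1 ∈ nhdsWithin (1 : ℝ) (Set.Iio 1) :=
    Ico_mem_nhdsLT one_pos
  -- The binomial expansion is only available for `w < 1`. Each partial sum at `1` is a limit of
  -- partial sums as `w` tends to `1` from below, all bounded by `1`.
  have hsum : Summable a := by
    refine summable_of_sum_range_le (c := 1) ha0 fun N => ?_
    have hcont : Continuous fun w : ℝ => ∑ i ∈ Finset.range N, a i * w ^ i := by fun_prop
    have ht := (hcont.tendsto 1).mono_left (nhdsWithin_le_nhds (s := Set.Iio 1))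
    simp only [one_pow, mul_one] at ht
    refine le_of_tendsto ht ?_
    filter_upwards [hmem] with w hw
    refine (sum_le_hasSum _ (fun n _ => mul_nonneg (ha0 n) (pow_nonneg hw.1 n)) (hlt w hw)).trans ?_
    have := Real.rpow_nonneg (sub_nonneg.2 hw.2.le) δ
    linarith
  have h1 : HasSum a 1 := by
    -- Abel's limit theorem identifies the total mass with the limit of `1 - (1 - w) ^ δ`; `δ > 0`
    -- makes this limit `1`.
    have h := Real.tendsto_tsum_powerSeries_nhdsWithin_lt hsum.hasSum.tendsto_sum_nat
    have h' : Filter.Tendsto (fun x : ℝ => 1 - (1 - x) ^ δ) (nhdsWithin 1 (Set.Iio 1)) (nhds 1) := by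
      have hcont : Continuous fun x : ℝ => 1 - (1 - x) ^ δ := by
        have := Real.continuous_rpow_const hδ.1.le
        fun_prop
      have := (hcont.tendsto 1).mono_left (nhdsWithin_le_nhds (s := Set.Iio 1))
      simpa [Real.zero_rpow hδ.1.ne'] using this
    have heq : ∑' n, a n = 1 := by
      refine tendsto_nhds_unique h (h'.congr' ?_)
      filter_upwards [hmem] with w hw using (hlt w hw).tsum_eq.symm
    rw [← heq]
    exact hsum.hasSum
  obtain ⟨μ, hμ, hμa⟩ := exists_measureReal_singleton_eq ha0 h1
  refine ⟨μ, hμ, fun w hw => ?_⟩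
  have h := hasSum_integral_pow hw μ
  simp_rw [hμa] at h
  rcases hw.2.lt_or_eq with hw1 | rfl
  · exact h.unique (hlt w ⟨hw.1, hw1⟩)
  · simp [Real.zero_rpow hδ.1.ne']

/-! ### The geometric law -/

lemma exists_isGeometricFromOne {κ : ℝ} (hκ : κ ∈ Set.Ico (0 : ℝ) 1) :
    ∃ μ : Measure ℕ, IsGeometricFromOne κ μ := by
  set c : ℕ → ℝ := fun n => n.casesOn 0 fun m => (1 - κ) * κ ^ m with hc
  have hc0 : ∀ n, 0 ≤ c n := by
    rintro (_ | n)
    · exact le_rfl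
    · exact mul_nonneg (sub_nonneg.2 hκ.2.le) (pow_nonneg hκ.1 n)
  have h1 : HasSum c 1 := by
    rw [← hasSum_nat_add_iff' 1]
    have := (hasSum_geometric_of_lt_one hκ.1 hκ.2).mul_left (1 - κ)
    rw [mul_inv_cancel₀ (sub_pos.2 hκ.2).ne'] at this
    simpa [hc] using this
  obtain ⟨μ, hμ, hμc⟩ := exists_measureReal_singleton_eq hc0 h1
  exact ⟨μ, hμ, fun n => hμc (n + 1)⟩

lemma one_sub_mul_pos {κ z : ℝ} (hκ : κ ∈ Set.Ico (0 : ℝ) 1) (hz : z ∈ Set.Icc (0 : ℝ) 1) :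
    0 < 1 - κ * z := by
  nlinarith [hκ.1, hκ.2, hz.1, hz.2]

lemma div_one_sub_mul_mem_Icc {κ z : ℝ} (hκ : κ ∈ Set.Ico (0 : ℝ) 1)
    (hz : z ∈ Set.Icc (0 : ℝ) 1) : (1 - z) / (1 - κ * z) ∈ Set.Icc (0 : ℝ) 1 := by
  have h := one_sub_mul_pos hκ hz
  refine ⟨div_nonneg (sub_nonneg.2 hz.2) h.le, (div_le_one h).2 ?_⟩
  nlinarith [hκ.1, hκ.2, hz.1, hz.2]

lemma IsGeometricFromOne.integral_pow {κ : ℝ} {μ : Measure ℕ} (h : IsGeometricFromOne κ μ)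
    (hκ : κ ∈ Set.Ico (0 : ℝ) 1) {z : ℝ} (hz : z ∈ Set.Icc (0 : ℝ) 1) :
    ∫ n : ℕ, z ^ n ∂μ = 1 - (1 - z) / (1 - κ * z) := by
  have := h.isProbabilityMeasure
  have hsum : ∀ x ∈ Set.Icc (0 : ℝ) 1,
      ∫ n : ℕ, x ^ n ∂μ = μ.real {0} + (1 - (1 - x) / (1 - κ * x)) := by
    intro x hx
    have hpos := one_sub_mul_pos hκ hx
    have h1 := hasSum_integral_pow hx μ
    rw [← hasSum_nat_add_iff' 1] at h1
    simp_rw [h.mass_eq] at h1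
    have hlt : κ * x < 1 := by linarith
    have h2 := (hasSum_geometric_of_lt_one (mul_nonneg hκ.1 hx.1) hlt).mul_left ((1 - κ) * x)
    have h3 := h1.unique (h2.congr_fun fun n => by rw [mul_pow, pow_succ]; ring)
    simp only [Finset.range_one, Finset.sum_singleton, pow_zero, mul_one] at h3
    rw [sub_eq_iff_eq_add'.1 h3]
    congr 1
    field_simp
    ring
  -- `mass_eq` says nothing about `0`; the masses on `n ≥ 1` already add up to `1`, as seen at `z =
  -- 1`.
  have h0 : μ.real {0} = 0 := by
    have := hsum 1 (by simp)
    simp at this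
    linarith
  rw [hsum z hz, h0, zero_add]

/-! ### Existence and uniqueness of `PDS(δ, t, κ)` -/

/-- The kernel `t ↦ PDS(δ, t, κ)`: a Poisson number of Sibuya variables, each counting
geometric variables. -/
lemma exists_kernel_isPDS {δ κ : ℝ} (hδ : δ ∈ Set.Ioc (0 : ℝ) 1) (hκ : κ ∈ Set.Ico (0 : ℝ) 1) :
    ∃ k : Kernel ℝ≥0 ℕ, ∀ t : ℝ≥0, IsPDS δ t κ (k t) := by
  obtain ⟨g, hg⟩ := exists_isGeometricFromOne hκ
  have := hg.isProbabilityMeasure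
  obtain ⟨s, _, hs⟩ := exists_sibuya hδ
  obtain ⟨G, _, hG⟩ := exists_kernel_integral_pow_eq_pow g
  -- `G ∘ₘ s` is the law of a Sibuya number of geometric variables, and `Q j` that of a sum of `j`
  -- independent copies of it.
  obtain ⟨Q, _, hQ⟩ := exists_kernel_integral_pow_eq_pow (G ∘ₘ s)
  let p : Kernel ℝ≥0 ℕ := ⟨poissonMeasure, measurable_poissonMeasure⟩
  have : IsMarkovKernel p := ⟨fun t => inferInstanceAs (IsProbabilityMeasure (poissonMeasure t))⟩
  refine ⟨Q ∘ₖ p, fun t => ⟨inferInstance, fun z hz => ?_⟩⟩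
  have hx := div_one_sub_mul_mem_Icc hκ hz
  have hw : 1 - (1 - z) / (1 - κ * z) ∈ Set.Icc (0 : ℝ) 1 :=
    ⟨sub_nonneg.2 hx.2, sub_le_self _ hx.1⟩
  have hy : 1 - ((1 - z) / (1 - κ * z)) ^ δ ∈ Set.Icc (0 : ℝ) 1 :=
    ⟨sub_nonneg.2 (Real.rpow_le_one hx.1 hx.2 hδ.1.le), sub_le_self _ (Real.rpow_nonneg hx.1 δ)⟩
  have hsib : ∫ n : ℕ, z ^ n ∂(G ∘ₘ s) = 1 - ((1 - z) / (1 - κ * z)) ^ δ := by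
    rw [integral_pow_comp G s hz]
    simp_rw [hG _ z hz, hg.integral_pow hκ hz]
    rw [hs _ hw, sub_sub_cancel]
  rw [Kernel.comp_apply, integral_pow_comp Q _ hz]
  simp_rw [hQ _ z hz, hsib]
  change ∫ n : ℕ, _ ∂(poissonMeasure t) = _
  rw [integral_pow_poissonMeasure t _ hy, sub_sub_cancel]

lemma IsPDS.eq {δ t κ : ℝ} {μ ν : Measure ℕ} (hμ : IsPDS δ t κ μ) (hν : IsPDS δ t κ ν) :
    μ = ν :=
  have := hμ.isProbabilityMeasure
  have := hν.isProbabilityMeasure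
  measure_eq_of_integral_pow_eq fun z hz => by rw [hμ.pgf_eq z hz, hν.pgf_eq z hz]

/-! ### Stable mixtures and random sums -/

/-- Laplace transform of a stable law scaled by `lam ^ (1 / γ)`. -/
lemma IsPositiveStable.integral_exp_scaled {γ lam : ℝ} {σ : Measure ℝ}
    (h : IsPositiveStable γ σ) (hγ : 0 < γ) (hlam : 0 ≤ lam) {x : ℝ} (hx : 0 ≤ x) :
    ∫ s, Real.exp (-(lam ^ (1 / γ) * s * x)) ∂σ = Real.exp (-(lam * x ^ γ)) := by
  have hl : 0 ≤ lam ^ (1 / γ) := Real.rpow_nonneg hlam _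
  have := h.laplace_eq (lam ^ (1 / γ) * x) (mul_nonneg hl hx)
  rw [Real.mul_rpow hl hx, ← Real.rpow_mul hlam, one_div_mul_cancel hγ.ne', Real.rpow_one] at this
  rw [← this]
  simp_rw [mul_right_comm]

lemma integral_pow_map_eq_integral_condDistrib {Ω : Type*} [MeasurableSpace Ω] (P : Measure Ω)
    [IsProbabilityMeasure P] {S : Ω → ℝ} {Z : Ω → ℕ} (hS : Measurable S) (hZ : Measurable Z)
    {z : ℝ} (hz : z ∈ Set.Icc (0 : ℝ) 1) :
    ∫ n : ℕ, z ^ n ∂(P.map Z) = ∫ s, ∫ n : ℕ, z ^ n ∂(condDistrib Z S P s) ∂(P.map S) := by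
  have := Measure.isProbabilityMeasure_map (μ := P) hS.aemeasurable
  rw [← condDistrib_comp_map (X := S) hS.aemeasurable hZ.aemeasurable, integral_pow_comp _ _ hz]

lemma isPDS_map_of_condDistrib {Ω : Type*} [MeasurableSpace Ω] (P : Measure Ω)
    [IsProbabilityMeasure P] {γ γ' lam κ : ℝ} (hγ : 0 < γ) (hlam : 0 ≤ lam)
    (hκ : κ ∈ Set.Ico (0 : ℝ) 1) {S : Ω → ℝ} {Z : Ω → ℕ} (hS : Measurable S) (hZ : Measurable Z)
    (hst : IsPositiveStable γ (P.map S))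
    (h : ∀ᵐ s ∂(P.map S), IsPDS (γ' / γ) (lam ^ (1 / γ) * s) κ (condDistrib Z S P s)) :
    IsPDS γ' lam κ (P.map Z) := by
  refine ⟨Measure.isProbabilityMeasure_map hZ.aemeasurable, fun z hz => ?_⟩
  have hx := div_one_sub_mul_mem_Icc hκ hz
  rw [integral_pow_map_eq_integral_condDistrib P hS hZ hz,
    integral_congr_ae (h.mono fun s hs => hs.pgf_eq z hz),
    hst.integral_exp_scaled hγ hlam (Real.rpow_nonneg hx.1 _), ← Real.rpow_mul hx.1,
    div_mul_cancel₀ _ hγ.ne']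

/-- Generating function of a mixed Poisson law with stable intensity. -/
lemma integral_pow_map_of_condDistrib_poisson {Ω : Type*} [MeasurableSpace Ω] (P : Measure Ω)
    [IsProbabilityMeasure P] {γ lam : ℝ} (hγ : 0 < γ) (hlam : 0 ≤ lam) {S : Ω → ℝ} {N : Ω → ℕ}
    (hS : Measurable S) (hN : Measurable N) (hst : IsPositiveStable γ (P.map S))
    (h : ∀ᵐ s ∂(P.map S),
      condDistrib N S P s = poissonMeasure (Real.toNNReal (lam ^ (1 / γ) * s)))
    {w : ℝ} (hw : w ∈ Set.Icc (0 : ℝ) 1) :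
    ∫ n : ℕ, w ^ n ∂(P.map N) = Real.exp (-(lam * (1 - w) ^ γ)) := by
  rw [integral_pow_map_eq_integral_condDistrib P hS hN hw,
    ← hst.integral_exp_scaled hγ hlam (sub_nonneg.2 hw.2)]
  refine integral_congr_ae ?_
  -- Almost sure nonnegativity of `S` makes the truncation in `Real.toNNReal` harmless.
  filter_upwards [h, hst.nonneg] with s hs hs0
  rw [hs, integral_pow_poissonMeasure _ _ hw,
    Real.coe_toNNReal _ (mul_nonneg (Real.rpow_nonneg hlam _) hs0)]

/-- Generating function of a random sum of independent, identically distributed variables. -/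
lemma integral_pow_random_sum {Ω : Type*} [MeasurableSpace Ω] (P : Measure Ω)
    [IsProbabilityMeasure P] {N : Ω → ℕ} {Y : ℕ → Ω → ℕ} (hN : Measurable N)
    (hY : ∀ j, Measurable (Y j)) (hind : iIndepFun Y P)
    (hNY : IndepFun N (fun ω j => Y j ω) P) {z w : ℝ} (hz : z ∈ Set.Icc (0 : ℝ) 1)
    (hw : ∀ j, ∫ n : ℕ, z ^ n ∂(P.map (Y j)) = w) :
    ∫ n : ℕ, z ^ n ∂(P.map fun ω => ∑ j ∈ Finset.range (N ω), Y j ω) =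
      ∫ n : ℕ, w ^ n ∂(P.map N) := by
  have hYs : Measurable fun ω j => Y j ω := measurable_pi_lambda _ hY
  let T : ℕ × (ℕ → ℕ) → ℕ := fun x => ∑ j ∈ Finset.range x.1, x.2 j
  have hT : Measurable T := measurable_from_prod_countable_right fun n => by
    simp only [T]; fun_prop
  have := Measure.isProbabilityMeasure_map (μ := P) hN.aemeasurable
  have := Measure.isProbabilityMeasure_map (μ := P) hYs.aemeasurable
  have hmap : P.map (fun ω => ∑ j ∈ Finset.range (N ω), Y j ω) =
      ((P.map N).prod (P.map fun ω j => Y j ω)).map T := by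
    rw [← (indepFun_iff_map_prod_eq_prod_map_map hN.aemeasurable hYs.aemeasurable).1 hNY,
      Measure.map_map hT (hN.prodMk hYs)]
    rfl
  rw [hmap, integral_map hT.aemeasurable (by fun_prop),
    integral_prod _ (integrable_pow_of_mem_Icc hz _ hT)]
  -- By independence of `N` and `Y`, Fubini fixes `N = n`; what remains is the product of `n`
  -- independent factors, each of mean `w`.
  refine integral_congr_ae (ae_of_all _ fun n => ?_)
  have hTn : Measurable fun y => T (n, y) := hT.comp measurable_prodMk_left
  dsimp only
  rw [integral_map (f := fun y => z ^ T (n, y)) hYs.aemeasurable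
    ((Measurable.of_discrete (f := fun n : ℕ => z ^ n)).comp hTn).aestronglyMeasurable]
  simp only [T, ← Finset.prod_pow_eq_pow_sum]
  simp_rw [← Fin.prod_univ_eq_prod_range (fun j => z ^ (Y j _)) n]
  have hfin : iIndepFun (fun i : Fin n => Y i) P := hind.precomp Fin.val_injective
  rw [hfin.integral_fun_prod_comp (f := fun _ k => z ^ k) (fun i => (hY i).aemeasurable)
    (fun i => by fun_prop)]
  have hj : ∀ j, ∫ ω, z ^ (Y j ω) ∂P = w := fun j => by
    rw [← hw j, integral_map (hY j).aemeasurable (by fun_prop)]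
  simp [hj]

theorem mainTheorem6 (γ γ' lam κ : ℝ)
    (hγ : γ ∈ Set.Ioc (0 : ℝ) 1) (hγ' : γ' ∈ Set.Ioc (0 : ℝ) 1) (hle : γ' ≤ γ)
    (hlam : 0 < lam) (hκ : κ ∈ Set.Ico (0 : ℝ) 1) :
    -- the laws `PDS(δ, t, κ)` exist, are unique, and depend measurably on the intensity `t`
    (∀ δ ∈ Set.Ioc (0 : ℝ) 1, ∃ k : Kernel ℝ≥0 ℕ, ∀ t : ℝ≥0,
      IsPDS δ t κ (k t) ∧ ∀ μ : Measure ℕ, IsPDS δ t κ μ → μ = k t) ∧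
    -- a `PDS(γ' / γ, lam ^ (1 / γ) * S, κ)` variable with `S` stable is `PDS(γ', lam, κ)`
    (∀ {Ω : Type*} [MeasurableSpace Ω] (P : Measure Ω) [IsProbabilityMeasure P]
      (S : Ω → ℝ) (Z : Ω → ℕ), Measurable S → Measurable Z →
      IsPositiveStable γ (P.map S) →
      (∀ᵐ s ∂(P.map S), IsPDS (γ' / γ) (lam ^ (1 / γ) * s) κ (condDistrib Z S P s)) →
      IsPDS γ' lam κ (P.map Z)) ∧
    -- compound Poisson-geometric representation with random stable intensity
    (∀ {Ω : Type*} [MeasurableSpace Ω] (P : Measure Ω) [IsProbabilityMeasure P]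
      (S : Ω → ℝ) (N : Ω → ℕ) (Y : ℕ → Ω → ℕ),
      Measurable S → Measurable N → (∀ j, Measurable (Y j)) →
      IsPositiveStable γ (P.map S) →
      (∀ᵐ s ∂(P.map S),
        condDistrib N S P s = poissonMeasure (Real.toNNReal (lam ^ (1 / γ) * s))) →
      iIndepFun Y P → (∀ j, IsGeometricFromOne κ (P.map (Y j))) →
      IndepFun N (fun ω j => Y j ω) P →
      IsPDS γ lam κ (P.map (fun ω => ∑ j ∈ Finset.range (N ω), Y j ω))) := by
  refine ⟨fun δ hδ => ?_, ?_, ?_⟩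
  · obtain ⟨k, hk⟩ := exists_kernel_isPDS hδ hκ
    exact ⟨k, fun t => ⟨hk t, fun μ hμ => hμ.eq (hk t)⟩⟩
  · intro Ω _ P _ S Z hS hZ hst h
    exact isPDS_map_of_condDistrib P hγ.1 hlam.le hκ hS hZ hst h
  · intro Ω _ P _ S N Y hS hN hY hst h hind hgeo hNY
    have hsum : Measurable fun ω => ∑ j ∈ Finset.range (N ω), Y j ω :=
      (measurable_from_prod_countable_right (f := fun x : ℕ × Ω =>
        ∑ j ∈ Finset.range x.1, Y j x.2) fun n => by
          dsimp only; fun_prop).comp (hN.prodMk measurable_id)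
    refine ⟨Measure.isProbabilityMeasure_map hsum.aemeasurable, fun z hz => ?_⟩
    have hx := div_one_sub_mul_mem_Icc hκ hz
    rw [integral_pow_random_sum P hN hY hind hNY hz fun j => (hgeo j).integral_pow hκ hz,
      integral_pow_map_of_condDistrib_poisson P hγ.1 hlam.le hS hN hst h
        ⟨sub_nonneg.2 hx.2, sub_le_self _ hx.1⟩, sub_sub_cancel]
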